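/- **Setting.** Let $n$ be a number of arms. A (stochastic combinatorial semi-bandit) problem consists of a nonempty action space $\mathcal A$ of subsets of $[n]$ and the law $\mathbb P_{\mathbf X}$ of a random vector $\mathbf X\in\mathbb R^n$ of outcomes. At each round $t\ge 1$ a (possibly randomized) policy, which knows $\mathcal A$, chooses $A_t\in\mathcal A$ on the basis of $A_u$ and $(X_{i,u}\mathbb 1\{i\in A_u\})_{i\in[n]}$, $u<t$; then $\mathbf X_t\sim\mathbb P_{\mathbf X}$ is drawn independently of the past and of $A_t$. Let $A^*\in\arg\max_{A\in\mathcal A}\mathbb E\big[\sum_{i\in A}X_i\big]$. The gap of $A\in\mathcal A$ is $\Delta(A)=\mathbb E\big[\sum_{i\in A^*}X_i-\sum_{i\in A}X_i\big]$, and the regret is $R_T=\mathbb E\big[\sum_{t=1}^T\big(\sum_{i\in A^*}X_{i,t}-\sum_{i\in A_t}X_{i,t}\big)\big]$. For $m,s\in\mathbb N^*$, let $\mathcal P(n,m,s)$ be the class of problems with $n$ arms such that $\max_{A\in\mathcal A}|A|=m$ and, almost surely, $\|\mathbf X\|_\infty\le 1$ and $\|\mathbf X\|_0\le s$. A policy is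 called consistent if $R_T=o(T^a)$ as $T\to\infty$ for every $a>0$ on every problem of $\mathcal P(n,m,s)$. **Theorem.** Let $n,m,s\in\mathbb N^*$ be such that $n/m$, $n/s$ and $\max(1,s/m)$ are integers, $n/m\ge 2$ and $n/s\ge 2$. Let $0<\Delta\le \frac{ms}{2(n-m)}$. Then for every consistent policy there is a problem in $\mathcal P(n,m,s)$ with at least two actions and an optimal action $A^*$, all of whose other actions have gap exactly $\Delta$, and on which $$\liminf_{T\to\infty}\frac{\Delta}{\log T}R_T\ \ge\ \frac{s\,\min(s,m)\,\big(1-\frac{2m}{n}\big)}{4}.$$ (The lower limit may be $+\infty$.) -/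

import Mathlib

open MeasureTheory ProbabilityTheory Filter Asymptotics

namespace SemiBandit

/-- An action is a subset of the `n` base arms. -/
abbrev Action (n : ℕ) : Type := Finset (Fin n)

/-- A round: the chosen action together with a vector indexed by the arms (either the full vector
of outcomes, or the part of it that the agent observes). -/
abbrev Round (n : ℕ) : Type := Action n × (Fin n → ℝ)

/-- Semi-bandit feedback: the agent sees the action `A` and the vector `(X i 𝟙{i ∈ A})_i`. -/
def feedback {n : ℕ} (r : Round n) : Round n :=
  (r.1, fun i => if i ∈ r.1 then r.2 i else 0)

theorem measurable_feedback {n : ℕ} : Measurable (feedback (n := n)) := by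
  refine measurable_fst.prodMk (measurable_pi_lambda _ fun i => ?_)
  refine Measurable.ite ?_ ((measurable_pi_apply i).comp measurable_snd) measurable_const
  exact measurable_fst (MeasurableSet.of_discrete (s := {A : Action n | i ∈ A}))

/-- Coordinatewise feedback on the first `t` rounds. -/
def observed {n t : ℕ} (h : Fin t → Round n) : Fin t → Round n := fun u => feedback (h u)

theorem measurable_observed {n t : ℕ} : Measurable (observed (n := n) (t := t)) :=
  measurable_pi_lambda _ fun u => measurable_feedback.comp (measurable_pi_apply u)

/-- A stochastic combinatorial semi-bandit problem with `n` arms: a nonempty action space and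
the law of the vector of outcomes. -/
structure Problem (n : ℕ) where
  actions : Finset (Action n)
  nonempty : actions.Nonempty
  law : Measure (Fin n → ℝ)
  isProb : IsProbabilityMeasure law

attribute [instance] Problem.isProb

/-- A (possibly randomized) policy for `n` arms. Knowing the action space and the feedback of the
first `t` rounds, it draws an element of the action space for the next round. -/
structure Policy (n : ℕ) where
  act : Finset (Action n) → (t : ℕ) → Kernel (Fin t → Round n) (Action n)
  markov : ∀ 𝒜 t, IsMarkovKernel (act 𝒜 t)
  mem_actions : ∀ 𝒜 : Finset (Action n), 𝒜.Nonempty → ∀ t h, act 𝒜 t h {A | A ∉ 𝒜} = 0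

attribute [instance] Policy.markov

/-- The conditional law of the pair (action, outcome vector) of the next round given the first `t`
rounds: the action is drawn by the policy from the feedback only, and the outcome vector is drawn
from the law of the problem, independently of the past and of the action. -/
noncomputable def nextRound {n : ℕ} (B : Problem n) (π : Policy n) (t : ℕ) :
    Kernel (Fin t → Round n) (Round n) :=
  ((π.act B.actions t).comap observed measurable_observed) ×ₖ Kernel.const _ B.law

instance isMarkovKernel_nextRound {n : ℕ} (B : Problem n) (π : Policy n) (t : ℕ) :
    IsMarkovKernel (nextRound B π t) := by
  unfold nextRound; infer_instance

/-- The joint law of the pairs `(A₁, X₁), …, (A_t, X_t)` when `π` is run on `B`. -/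
noncomputable def runLaw {n : ℕ} (B : Problem n) (π : Policy n) :
    (t : ℕ) → Measure (Fin t → Round n)
  | 0 => Measure.dirac Fin.elim0
  | t + 1 => ((runLaw B π t) ⊗ₘ (nextRound B π t)).map
      (fun p => (Fin.snoc (α := fun _ => Round n) p.1 p.2 : Fin (t + 1) → Round n))

theorem measurable_snoc {n t : ℕ} :
    Measurable (fun p : (Fin t → Round n) × Round n =>
      (Fin.snoc (α := fun _ => Round n) p.1 p.2 : Fin (t + 1) → Round n)) := by
  refine measurable_pi_lambda _ fun u => ?_
  induction u using Fin.lastCases with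
  | last => simpa using measurable_snd
  | cast u =>
    simp only [Fin.snoc_castSucc]
    exact (measurable_pi_apply u).comp measurable_fst

instance isProbabilityMeasure_runLaw {n : ℕ} (B : Problem n) (π : Policy n) (t : ℕ) :
    IsProbabilityMeasure (runLaw B π t) := by
  induction t with
  | zero => unfold runLaw; infer_instance
  | succ t ih =>
    unfold runLaw
    exact Measure.isProbabilityMeasure_map measurable_snoc.aemeasurable

/-- Mean of the `i`-th outcome. -/
noncomputable def Problem.mean {n : ℕ} (B : Problem n) (i : Fin n) : ℝ := ∫ x, x i ∂B.law

/-- Expected reward of an action. -/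
noncomputable def Problem.value {n : ℕ} (B : Problem n) (A : Action n) : ℝ := ∑ i ∈ A, B.mean i

/-- `Astar` is an optimal action of the problem. -/
def Problem.IsOptimal {n : ℕ} (B : Problem n) (Astar : Action n) : Prop :=
  Astar ∈ B.actions ∧ ∀ A ∈ B.actions, B.value A ≤ B.value Astar

/-- The regret after `T` rounds, with respect to the action `Astar`:
`𝔼[∑_{t ≤ T} (∑_{i ∈ Astar} X_{i,t} - ∑_{i ∈ A_t} X_{i,t})]`. -/
noncomputable def regret {n : ℕ} (B : Problem n) (π : Policy n) (Astar : Action n) (T : ℕ) : ℝ :=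
  ∫ h, ∑ t : Fin T, (∑ i ∈ Astar, (h t).2 i - ∑ i ∈ (h t).1, (h t).2 i) ∂(runLaw B π T)

/-- The `s`-sparse problems with maximal action size `m`: almost surely `‖X‖_∞ ≤ 1` and
`‖X‖₀ ≤ s`. -/
structure Problem.IsSparse {n : ℕ} (B : Problem n) (m s : ℕ) : Prop where
  max_card : B.actions.sup Finset.card = m
  bounded : ∀ᵐ x ∂B.law, ‖x‖ ≤ 1
  sparse : ∀ᵐ x ∂B.law, (Finset.univ.filter fun i => x i ≠ 0).card ≤ s

/-- Consistency on the `s`-sparse problems with maximal action size `m`: on each of them, the regret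
is `o(T ^ a)` for every `a > 0`. -/
def Policy.IsConsistent {n : ℕ} (π : Policy n) (m s : ℕ) : Prop :=
  ∀ B : Problem n, B.IsSparse m s → ∀ Astar, B.IsOptimal Astar → ∀ a : ℝ, 0 < a →
    (fun T : ℕ => regret B π Astar T) =o[atTop] fun T : ℕ => (T : ℝ) ^ a

end SemiBandit

namespace SemiBandit

/-! Write `n = k * M * m` and `s = k * b` with `b = min s m`, and cut the arms into `k * M` blocks
of `m` arms, which are the actions. A random set `W` of at most `k` blocks is drawn, and the outcome
is `1` on the first `b` arms of each block in `W`, so at most `k * b = s` coordinates are nonzero.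
Playing a block reveals one Bernoulli bit, whether the block lies in `W`. Hence only the marginals
of `W` matter for learning, while its correlations are free to enforce sparsity: drawing `k` blocks
at once (`exists_measure_finset`) gives each of them marginal `p` at the price of a single event of
probability `p`.

In the hard problem every block has marginal `p`, except an optimal one with `p + δ`, where `b * δ =
Δ`. For each suboptimal block `a`, an alternative raises only the marginal of `a`, to `p + δ + ε`,
and makes `a` optimal. A consistent policy must tell the two apart, and only plays of `a` help. Each
play carries relative entropy at most `(δ + ε) ^ 2 / (r * (1 - r))` with `r = p + δ + ε`
(`bernoulli_log_ratio_ge`), so `a` is played at least about `log T * r * (1 - r) / δ ^ 2` times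
(`eventually_mul_log_le_expectedPlays`). Since `r * (1 - r)` can be kept above about `1 / (4 * M)`,
summing the cost `b * δ` over the `k * M - 1` suboptimal blocks yields the bound
(`exists_hard_problem`).

The information inequality (`exp_integral_add_le`) is Jensen's inequality applied after a change of
measure on the observed history. -/

variable {n : ℕ}

/-! ### Integration along a run and change of measure. -/

theorem measurable_snoc_comp {α : Type*} [MeasurableSpace α] {t : ℕ} {f : α → Fin t → Round n}
    {g : α → Round n} (hf : Measurable f) (hg : Measurable g) :
    Measurable fun a => (Fin.snoc (α := fun _ => Round n) (f a) (g a) : Fin (t + 1) → Round n) :=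
  measurable_snoc.comp (hf.prodMk hg)

theorem observed_snoc {t : ℕ} (h : Fin t → Round n) (r : Round n) :
    observed (Fin.snoc (α := fun _ => Round n) h r : Fin (t + 1) → Round n) =
      (Fin.snoc (α := fun _ => Round n) (observed h) (feedback r) : Fin (t + 1) → Round n) := by
  funext u
  induction u using Fin.lastCases with
  | last => simp [observed]
  | cast u => simp [observed]

theorem lintegral_nextRound (B : Problem n) (π : Policy n) (t : ℕ) (h : Fin t → Round n)
    {G : Round n → ENNReal} (hG : Measurable G) :
    ∫⁻ r, G r ∂(nextRound B π t h) =
      ∫⁻ A, ∫⁻ x, G (A, x) ∂B.law ∂(π.act B.actions t (observed h)) := by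
  rw [nextRound, Kernel.prod_apply, lintegral_prod _ hG.aemeasurable]
  simp [Kernel.comap_apply]

theorem lintegral_runLaw_succ (B : Problem n) (π : Policy n) (t : ℕ)
    {F : (Fin (t + 1) → Round n) → ENNReal} (hF : Measurable F) :
    ∫⁻ h, F h ∂(runLaw B π (t + 1)) =
      ∫⁻ h, ∫⁻ A, ∫⁻ x, F (Fin.snoc (α := fun _ => Round n) h (A, x)) ∂B.law
        ∂(π.act B.actions t (observed h)) ∂(runLaw B π t) := by
  have hF' : Measurable fun p : (Fin t → Round n) × Round n =>
      F (Fin.snoc (α := fun _ => Round n) p.1 p.2) := hF.comp measurable_snoc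
  rw [runLaw, lintegral_map hF measurable_snoc, Measure.lintegral_compProd hF']
  refine lintegral_congr fun h => ?_
  have := lintegral_nextRound B π t h
    (G := fun r => F (Fin.snoc (α := fun _ => Round n) h r))
    (hF.comp (measurable_snoc_comp measurable_const measurable_id))
  simpa using this

theorem ae_mem_actions (B : Problem n) (π : Policy n) (t : ℕ) (h : Fin t → Round n) :
    ∀ᵐ A ∂(π.act B.actions t h), A ∈ B.actions :=
  π.mem_actions B.actions B.nonempty t h

/-- Change of measure for functions of the observed history. -/
theorem lintegral_observed_change {B B' : Problem n} (π : Policy n)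
    (hB : B'.actions = B.actions) {w : Round n → ENNReal} (hw : Measurable w)
    (hlaw : ∀ A ∈ B.actions, ∀ G : Round n → ENNReal, Measurable G →
      ∫⁻ x, G (feedback (A, x)) ∂B'.law =
        ∫⁻ x, G (feedback (A, x)) * w (feedback (A, x)) ∂B.law)
    (t : ℕ) {F : (Fin t → Round n) → ENNReal} (hF : Measurable F) :
    ∫⁻ h, F (observed h) ∂(runLaw B' π t) =
      ∫⁻ h, F (observed h) * ∏ u, w (feedback (h u)) ∂(runLaw B π t) := by
  induction t with
  | zero => simp [runLaw]
  | succ t ih =>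
    have hprod : ∀ t, Measurable fun h : Fin t → Round n => ∏ u, w (feedback (h u)) := fun t =>
      Finset.measurable_prod _ fun u _ =>
        hw.comp (measurable_feedback.comp (measurable_pi_apply u))
    have hS : Measurable fun p : ((Fin t → Round n) × Action n) × (Fin n → ℝ) =>
        F (Fin.snoc (α := fun _ => Round n) p.1.1 (feedback (p.1.2, p.2))) := by
      refine hF.comp (measurable_snoc_comp (measurable_fst.comp measurable_fst)
        (measurable_feedback.comp ?_))
      exact (measurable_snd.comp measurable_fst).prodMk measurable_snd
    have hFo : Measurable fun h : Fin (t + 1) → Round n => F (observed h) :=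
      hF.comp measurable_observed
    have hFw : Measurable fun h : Fin (t + 1) → Round n =>
        F (observed h) * ∏ u, w (feedback (h u)) := hFo.mul (hprod (t + 1))
    rw [lintegral_runLaw_succ B' π t hFo, lintegral_runLaw_succ B π t hFw]
    simp only [observed_snoc, Fin.prod_univ_castSucc, Fin.snoc_castSucc,
      Fin.snoc_last]
    -- The policy reads only the feedback, so integrating out the last round leaves a function of
    -- the observed history, to which the induction hypothesis applies.
    have hΨ : Measurable fun o : Fin t → Round n =>
        ∫⁻ A, ∫⁻ x, F (Fin.snoc (α := fun _ => Round n) o (feedback (A, x))) ∂B'.law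
          ∂(π.act B'.actions t o) :=
      Measurable.lintegral_kernel_prod_right' (κ := π.act B'.actions t) hS.lintegral_prod_right'
    rw [ih hΨ]
    refine lintegral_congr fun h => ?_
    rw [hB, mul_comm, ← lintegral_const_mul]
    swap
    · exact hS.lintegral_prod_right'.comp measurable_prodMk_left
    refine lintegral_congr_ae ?_
    filter_upwards [ae_mem_actions B π t (observed h)] with A hA
    have hSA : Measurable fun r : Round n =>
        F (Fin.snoc (α := fun _ => Round n) (observed h) r) :=
      hF.comp (measurable_snoc_comp measurable_const measurable_id)
    rw [hlaw A hA _ hSA, ← lintegral_const_mul]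
    · refine lintegral_congr fun x => ?_
      ring
    · have : Measurable fun x : Fin n → ℝ => feedback (A, x) :=
        measurable_feedback.comp measurable_prodMk_left
      exact (hSA.comp this).mul (hw.comp this)

/-! ### Expected plays and the decomposition of the regret. -/

/-- In every round the outcome vector is independent of the action, which is in the action space. -/
theorem exists_runLaw_map_eval (B : Problem n) (π : Policy n) {T : ℕ} (t : Fin T) :
    ∃ ν : Measure (Action n), IsProbabilityMeasure ν ∧ (∀ᵐ A ∂ν, A ∈ B.actions) ∧
      (runLaw B π T).map (fun h => h t) = ν.prod B.law := by
  induction T with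
  | zero => exact t.elim0
  | succ T ih =>
    induction t using Fin.lastCases with
    | cast t =>
      obtain ⟨ν, h1, h2, h3⟩ := ih t
      refine ⟨ν, h1, h2, ?_⟩
      rw [← h3, runLaw, Measure.map_map (measurable_pi_apply _) measurable_snoc]
      have : ((fun h : Fin (T + 1) → Round n => h t.castSucc) ∘
          fun p : (Fin T → Round n) × Round n =>
            (Fin.snoc (α := fun _ => Round n) p.1 p.2 : Fin (T + 1) → Round n)) =
          (fun h => h t) ∘ Prod.fst := by
        funext p; simp
      rw [this, ← Measure.map_map (measurable_pi_apply _) measurable_fst]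
      congr 1
      exact Measure.fst_compProd _ _
    | last =>
      let κ := (π.act B.actions T).comap observed measurable_observed
      refine ⟨(runLaw B π T).bind κ, inferInstance, ?_, ?_⟩
      · rw [ae_iff, Measure.bind_apply (MeasurableSet.of_discrete) κ.aemeasurable]
        refine (lintegral_congr fun h => ?_).trans lintegral_zero
        exact π.mem_actions B.actions B.nonempty T (observed h)
      · refine Measure.ext_of_lintegral _ fun G hG => ?_
        have hGe : Measurable fun h : Fin (T + 1) → Round n => G (h (Fin.last T)) :=
          hG.comp (measurable_pi_apply _)
        rw [lintegral_map hG (measurable_pi_apply (Fin.last T)), lintegral_runLaw_succ B π T hGe,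
          lintegral_prod _ hG.aemeasurable, Measure.lintegral_bind κ.aemeasurable]
        · simp [κ, Kernel.comap_apply]
        · exact (measurable_of_finite _).aemeasurable

theorem ae_runLaw_mem_actions (B : Problem n) (π : Policy n) (T : ℕ) :
    ∀ᵐ h ∂(runLaw B π T), ∀ t, (h t).1 ∈ B.actions := by
  refine ae_all_iff.2 fun t => ?_
  obtain ⟨ν, _, hν, hmap⟩ := exists_runLaw_map_eval B π t
  have hS : MeasurableSet {r : Round n | r.1 ∈ B.actions} :=
    measurable_fst (MeasurableSet.of_discrete (s := {A : Action n | A ∈ B.actions}))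
  refine (ae_map_iff (μ := runLaw B π T) (measurable_pi_apply t).aemeasurable hS).1 ?_
  rw [hmap, Measure.ae_prod_iff_ae_ae hS]
  filter_upwards [hν] with A hA
  exact ae_of_all _ fun _ => hA

/-- By independence within a round, Fubini replaces a function of the round by its mean `v` given
the action. This serves both for the regret and for the log-likelihood ratio. -/
theorem integrable_and_integral_eval (B : Problem n) (π : Policy n) {φ : Round n → ℝ}
    (hφ : Measurable φ) {C : ℝ} (hC : ∀ A ∈ B.actions, ∀ᵐ x ∂B.law, |φ (A, x)| ≤ C)
    {v : Action n → ℝ} (hv : ∀ A ∈ B.actions, ∫ x, φ (A, x) ∂B.law = v A)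
    {T : ℕ} (t : Fin T) :
    Integrable (fun h => φ (h t)) (runLaw B π T) ∧
      ∫ h, φ (h t) ∂(runLaw B π T) = ∫ h, v (h t).1 ∂(runLaw B π T) := by
  obtain ⟨ν, _, hν, hmap⟩ := exists_runLaw_map_eval B π t
  have hm : AEMeasurable (fun h : Fin T → Round n => h t) (runLaw B π T) :=
    (measurable_pi_apply t).aemeasurable
  have hbd : ∀ᵐ r ∂(ν.prod B.law), ‖φ r‖ ≤ C := by
    rw [Measure.ae_prod_iff_ae_ae (measurableSet_le hφ.norm measurable_const)]
    filter_upwards [hν] with A hA using hC A hA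
  have hint : Integrable φ (ν.prod B.law) := Integrable.of_bound hφ.aestronglyMeasurable C hbd
  have hvm : Measurable fun r : Round n => v r.1 := (measurable_of_finite v).comp measurable_fst
  refine ⟨?_, ?_⟩
  · refine (integrable_map_measure (f := fun h : Fin T → Round n => h t) (g := φ) ?_ hm).1 ?_
    · exact hφ.aestronglyMeasurable
    · rwa [hmap]
  · rw [← integral_map (f := φ) hm hφ.aestronglyMeasurable,
      ← integral_map (f := fun r : Round n => v r.1) hm hvm.aestronglyMeasurable, hmap,
      integral_prod _ hint, integral_prod _ ?_]
    · refine integral_congr_ae ?_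
      filter_upwards [hν] with A hA
      simp [hv A hA]
    · exact Integrable.comp_fst (.of_finite) B.law

theorem integral_sum_runLaw (B : Problem n) (π : Policy n) {φ : Round n → ℝ}
    (hφ : Measurable φ) {C : ℝ} (hC : ∀ A ∈ B.actions, ∀ᵐ x ∂B.law, |φ (A, x)| ≤ C)
    {v : Action n → ℝ} (hv : ∀ A ∈ B.actions, ∫ x, φ (A, x) ∂B.law = v A) (T : ℕ) :
    ∫ h, ∑ t, φ (h t) ∂(runLaw B π T) = ∫ h, ∑ t, v (h t).1 ∂(runLaw B π T) := by
  have hvm : Measurable fun r : Round n => v r.1 := (measurable_of_finite v).comp measurable_fst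
  obtain ⟨D, hD⟩ := (Set.finite_range fun A => |v A|).bddAbove
  rw [integral_finsetSum, integral_finsetSum]
  · exact Finset.sum_congr rfl fun t _ => (integrable_and_integral_eval B π hφ hC hv t).2
  · intro t _
    refine (integrable_and_integral_eval B π hvm (C := D) (v := v) ?_ ?_ t).1
    · exact fun A _ => ae_of_all _ fun _ => hD ⟨A, rfl⟩
    · simp
  · exact fun t _ => (integrable_and_integral_eval B π hφ hC hv t).1

/-- The number of rounds in which the action `a` is chosen. -/
def plays (a : Action n) {T : ℕ} (h : Fin T → Round n) : ℝ :=
  ∑ t, if (h t).1 = a then 1 else 0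

/-- The expected number of rounds in which the action `a` is chosen. -/
noncomputable def expectedPlays (B : Problem n) (π : Policy n) (a : Action n) (T : ℕ) : ℝ :=
  ∫ h, plays a h ∂(runLaw B π T)

theorem measurable_plays (a : Action n) {T : ℕ} :
    Measurable (plays a : (Fin T → Round n) → ℝ) := by
  refine Finset.measurable_sum _ fun t _ => ?_
  exact (measurable_of_finite fun A : Action n => if A = a then (1 : ℝ) else 0).comp
    (measurable_fst.comp (measurable_pi_apply t))

theorem plays_nonneg (a : Action n) {T : ℕ} (h : Fin T → Round n) : 0 ≤ plays a h :=
  Finset.sum_nonneg fun t _ => by split_ifs <;> norm_num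

theorem plays_le (a : Action n) {T : ℕ} (h : Fin T → Round n) : plays a h ≤ T := by
  calc plays a h ≤ ∑ _t : Fin T, (1 : ℝ) :=
        Finset.sum_le_sum fun t _ => by split_ifs <;> norm_num
    _ = T := by simp

theorem plays_observed (a : Action n) {T : ℕ} (h : Fin T → Round n) :
    plays a (observed h) = plays a h := rfl

theorem integrable_plays (B : Problem n) (π : Policy n) (a : Action n) (T : ℕ) :
    Integrable (plays a) (runLaw B π T) := by
  refine Integrable.of_bound (measurable_plays a).aestronglyMeasurable (T : ℝ)
    (ae_of_all _ fun h => ?_)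
  rw [Real.norm_eq_abs, abs_of_nonneg (plays_nonneg a h)]
  exact plays_le a h

theorem expectedPlays_nonneg (B : Problem n) (π : Policy n) (a : Action n) (T : ℕ) :
    0 ≤ expectedPlays B π a T :=
  integral_nonneg fun h => plays_nonneg a h

theorem expectedPlays_le (B : Problem n) (π : Policy n) (a : Action n) (T : ℕ) :
    expectedPlays B π a T ≤ T := by
  calc expectedPlays B π a T ≤ ∫ _h, (T : ℝ) ∂(runLaw B π T) :=
        integral_mono (integrable_plays B π a T) (integrable_const _) fun h => plays_le a h
    _ = T := by simp

theorem integral_sum_indicator (B : Problem n) (π : Policy n) (a : Action n) (c : ℝ) (T : ℕ) :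
    ∫ h, ∑ t : Fin T, (if (h t).1 = a then c else 0) ∂(runLaw B π T) =
      c * expectedPlays B π a T := by
  rw [expectedPlays, ← integral_const_mul]
  refine integral_congr_ae (ae_of_all _ fun h => ?_)
  simp only [plays, Finset.mul_sum, mul_ite, mul_one, mul_zero]

theorem sum_expectedPlays (B : Problem n) (π : Policy n) (T : ℕ) :
    ∑ A ∈ B.actions, expectedPlays B π A T = T := by
  simp only [expectedPlays]
  rw [← integral_finsetSum _ fun A _ => integrable_plays B π A T]
  have : ∀ᵐ h ∂(runLaw B π T), ∑ A ∈ B.actions, plays A h = (T : ℝ) := by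
    filter_upwards [ae_runLaw_mem_actions B π T] with h hh
    simp only [plays]
    rw [Finset.sum_comm]
    simp [hh]
  rw [integral_congr_ae this]
  simp

theorem regret_eq_sum {B : Problem n} (hB : ∀ᵐ x ∂B.law, ‖x‖ ≤ 1) (π : Policy n)
    (Astar : Action n) (T : ℕ) :
    regret B π Astar T =
      ∑ A ∈ B.actions, (B.value Astar - B.value A) * expectedPlays B π A T := by
  have hxi : ∀ i : Fin n, Integrable (fun x : Fin n → ℝ => x i) B.law := fun i => by
    refine Integrable.of_bound (measurable_pi_apply i).aestronglyMeasurable 1 ?_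
    filter_upwards [hB] with x hx using (norm_le_pi_norm x i).trans hx
  have hφ : Measurable fun r : Round n => ∑ i ∈ Astar, r.2 i - ∑ i ∈ r.1, r.2 i := by
    have : (fun r : Round n => ∑ i ∈ Astar, r.2 i - ∑ i ∈ r.1, r.2 i) =
        fun r => ∑ i ∈ Astar, r.2 i - ∑ i, if i ∈ r.1 then r.2 i else 0 := by
      funext r
      rw [← Finset.sum_filter]
      simp
    rw [this]
    have h2 : ∀ i, Measurable fun r : Round n => r.2 i :=
      fun i => (measurable_pi_apply i).comp measurable_snd
    refine (Finset.measurable_sum _ fun i _ => h2 i).sub (Finset.measurable_sum _ fun i _ => ?_)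
    exact Measurable.ite
      (measurable_fst (MeasurableSet.of_discrete (s := {A : Action n | i ∈ A}))) (h2 i)
      measurable_const
  have hsum : ∀ x : Fin n → ℝ, ‖x‖ ≤ 1 → ∀ A : Action n, |∑ i ∈ A, x i| ≤ n := by
    intro x hx A
    calc |∑ i ∈ A, x i| ≤ ∑ i ∈ A, |x i| := Finset.abs_sum_le_sum_abs _ _
      _ ≤ ∑ _i ∈ A, (1 : ℝ) := Finset.sum_le_sum fun i _ => (norm_le_pi_norm x i).trans hx
      _ ≤ n := by
        simpa using (Finset.card_le_univ A)
  unfold regret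
  rw [integral_sum_runLaw B π hφ (C := n + n) (v := fun A => B.value Astar - B.value A)]
  · have : ∀ᵐ h ∂(runLaw B π T), ∑ t : Fin T, (B.value Astar - B.value (h t).1) =
        ∑ A ∈ B.actions, (B.value Astar - B.value A) * plays A h := by
      filter_upwards [ae_runLaw_mem_actions B π T] with h hh
      simp only [plays, Finset.mul_sum]
      rw [Finset.sum_comm]
      simp [hh]
    rw [integral_congr_ae this, integral_finsetSum _ fun A _ =>
      (integrable_plays B π A T).const_mul _]
    simp only [integral_const_mul, expectedPlays]
  · intro A _
    filter_upwards [hB] with x hx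
    exact (abs_sub _ _).trans (add_le_add (hsum x hx _) (hsum x hx _))
  · intro A _
    simp only
    rw [integral_sub (integrable_finsetSum _ fun i _ => hxi i)
      (integrable_finsetSum _ fun i _ => hxi i), integral_finsetSum _ fun i _ => hxi i,
      integral_finsetSum _ fun i _ => hxi i]
    rfl

theorem regret_nonneg {B : Problem n} (hB : ∀ᵐ x ∂B.law, ‖x‖ ≤ 1) (π : Policy n)
    {Astar : Action n} (hA : B.IsOptimal Astar) (T : ℕ) : 0 ≤ regret B π Astar T := by
  rw [regret_eq_sum hB]
  exact Finset.sum_nonneg fun A h => mul_nonneg (sub_nonneg.2 (hA.2 A h))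
    (expectedPlays_nonneg B π A T)

theorem mul_sub_expectedPlays_le_regret {B : Problem n} (hB : ∀ᵐ x ∂B.law, ‖x‖ ≤ 1)
    (π : Policy n) {Astar : Action n} (hA : Astar ∈ B.actions) {g : ℝ}
    (hg : ∀ A ∈ B.actions, A ≠ Astar → g ≤ B.value Astar - B.value A) (T : ℕ) :
    g * (T - expectedPlays B π Astar T) ≤ regret B π Astar T := by
  rw [regret_eq_sum hB, ← sum_expectedPlays B π T, ← Finset.add_sum_erase _ _ hA,
    ← Finset.add_sum_erase B.actions
      (fun A => (B.value Astar - B.value A) * expectedPlays B π A T) hA]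
  simp only [sub_self, zero_mul, zero_add, add_sub_cancel_left, Finset.mul_sum]
  refine Finset.sum_le_sum fun A hA' => ?_
  rw [Finset.mem_erase] at hA'
  exact mul_le_mul_of_nonneg_right (hg A hA'.2 hA'.1) (expectedPlays_nonneg B π A T)

/-! ### Information lower bound on the number of plays. -/

/-- The variational lower bound for the expected log-likelihood ratio `∑ g` of two problems. -/
theorem exp_integral_add_le {B B' : Problem n} (π : Policy n)
    (hB : B'.actions = B.actions) {g : Round n → ℝ} (hg : Measurable g) {C : ℝ}
    (hC : ∀ r, |g r| ≤ C)
    (hlaw : ∀ A ∈ B.actions, ∀ G : Round n → ENNReal, Measurable G →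
      ∫⁻ x, G (feedback (A, x)) ∂B'.law =
        ∫⁻ x, G (feedback (A, x)) * ENNReal.ofReal (Real.exp (g (feedback (A, x)))) ∂B.law)
    {T : ℕ} {f : (Fin T → Round n) → ℝ} (hf : Measurable f) {D : ℝ} (hD : ∀ h, |f h| ≤ D) :
    Real.exp (∫ h, f (observed h) ∂(runLaw B π T) +
        ∫ h, ∑ t, g (feedback (h t)) ∂(runLaw B π T)) ≤
      ∫ h, Real.exp (f (observed h)) ∂(runLaw B' π T) := by
  have hfo : Measurable fun h : Fin T → Round n => f (observed h) := hf.comp measurable_observed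
  have hgt : ∀ t : Fin T, Measurable fun h : Fin T → Round n => g (feedback (h t)) := fun t =>
    hg.comp (measurable_feedback.comp (measurable_pi_apply t))
  have hgs : Measurable fun h : Fin T → Round n => ∑ t, g (feedback (h t)) :=
    Finset.measurable_sum _ fun t _ => hgt t
  have hgb : ∀ h : Fin T → Round n, |∑ t, g (feedback (h t))| ≤ T * C := fun h => by
    calc |∑ t, g (feedback (h t))| ≤ ∑ t, |g (feedback (h t))| := Finset.abs_sum_le_sum_abs _ _
      _ ≤ ∑ _t : Fin T, C := Finset.sum_le_sum fun t _ => hC _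
      _ = T * C := by simp
  have hfi : Integrable (fun h => f (observed h)) (runLaw B π T) :=
    Integrable.of_bound hfo.aestronglyMeasurable D (ae_of_all _ fun h => hD _)
  have hgi : Integrable (fun h => ∑ t, g (feedback (h t))) (runLaw B π T) :=
    Integrable.of_bound hgs.aestronglyMeasurable (T * C) (ae_of_all _ hgb)
  have hsi : Integrable (fun h => Real.exp (f (observed h) + ∑ t, g (feedback (h t))))
      (runLaw B π T) := by
    refine Integrable.of_bound (Real.measurable_exp.comp (hfo.add hgs)).aestronglyMeasurable
      (Real.exp (D + T * C)) (ae_of_all _ fun h => ?_)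
    rw [Real.norm_eq_abs, Real.abs_exp]
    exact Real.exp_le_exp.2 (add_le_add ((le_abs_self _).trans (hD _))
      ((le_abs_self _).trans (hgb h)))
  have hf'i : Integrable (fun h => Real.exp (f (observed h))) (runLaw B' π T) := by
    refine Integrable.of_bound (Real.measurable_exp.comp hfo).aestronglyMeasurable
      (Real.exp D) (ae_of_all _ fun h => ?_)
    rw [Real.norm_eq_abs, Real.abs_exp]
    exact Real.exp_le_exp.2 ((le_abs_self _).trans (hD _))
  have hchange : ∫ h, Real.exp (f (observed h)) ∂(runLaw B' π T) =
      ∫ h, Real.exp (f (observed h) + ∑ t, g (feedback (h t))) ∂(runLaw B π T) := by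
    rw [← ENNReal.ofReal_eq_ofReal_iff (integral_nonneg fun _ => (Real.exp_pos _).le)
      (integral_nonneg fun _ => (Real.exp_pos _).le),
      ofReal_integral_eq_lintegral_ofReal hf'i (ae_of_all _ fun _ => (Real.exp_pos _).le),
      ofReal_integral_eq_lintegral_ofReal hsi (ae_of_all _ fun _ => (Real.exp_pos _).le)]
    have := lintegral_observed_change π hB (w := fun r => ENNReal.ofReal (Real.exp (g r)))
      (ENNReal.measurable_ofReal.comp (Real.measurable_exp.comp hg)) hlaw T
      (F := fun h => ENNReal.ofReal (Real.exp (f h)))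
      (ENNReal.measurable_ofReal.comp (Real.measurable_exp.comp hf))
    rw [this]
    refine lintegral_congr fun h => ?_
    rw [Real.exp_add, Real.exp_sum, ENNReal.ofReal_mul (Real.exp_pos _).le,
      ENNReal.ofReal_prod_of_nonneg fun _ _ => (Real.exp_pos _).le]
  rw [hchange, ← integral_add hfi hgi]
  -- Jensen's inequality for `exp` under the law of the first problem.
  exact convexOn_exp.map_integral_le Real.continuous_exp.continuousOn isClosed_univ
    (ae_of_all _ fun _ => Set.mem_univ _) (hfi.add hgi) hsi

/-- If only the feedback of the action `a` distinguishes two problems, with relative entropy `K`,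
then `a` has to be played often on the first one unless it is played rarely on the second one. -/
theorem le_log_one_add_of_change {B B' : Problem n} (π : Policy n)
    (hB : B'.actions = B.actions) {g : Round n → ℝ} (hg : Measurable g) {C : ℝ}
    (hC : ∀ r, |g r| ≤ C)
    (hlaw : ∀ A ∈ B.actions, ∀ G : Round n → ENNReal, Measurable G →
      ∫⁻ x, G (feedback (A, x)) ∂B'.law =
        ∫⁻ x, G (feedback (A, x)) * ENNReal.ofReal (Real.exp (g (feedback (A, x)))) ∂B.law)
    {a : Action n} {K : ℝ}
    (hK : ∀ A ∈ B.actions, ∫ x, g (feedback (A, x)) ∂B.law = if A = a then -K else 0)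
    {T : ℕ} (hT : 0 < T) {β : ℝ} (hβ : 0 ≤ β) :
    β * Real.log T * (1 - expectedPlays B π a T / T) - K * expectedPlays B π a T ≤
      Real.log (1 + (T : ℝ) ^ β * (1 - expectedPlays B' π a T / T)) := by
  have hT0 : (0 : ℝ) < T := by exact_mod_cast hT
  have hT1 : (1 : ℝ) ≤ T := by exact_mod_cast hT
  have hlog : 0 ≤ Real.log T := Real.log_nonneg hT1
  -- The test function satisfies `exp f = (T ^ β) ^ u`, with `u` the fraction of rounds not spent on
  -- `a`: `u` is close to `1` in mean on the first problem and tiny on the second.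
  set f : (Fin T → Round n) → ℝ := fun h => β * Real.log T * (1 - plays a h / T) with hfdef
  have hfm : Measurable f :=
    (measurable_const.sub ((measurable_plays a).div_const _)).const_mul _
  have hu : ∀ h : Fin T → Round n, 0 ≤ 1 - plays a h / T ∧ 1 - plays a h / T ≤ 1 := fun h =>
    ⟨sub_nonneg.2 ((div_le_one hT0).2 (plays_le a h)),
      sub_le_self _ (div_nonneg (plays_nonneg a h) hT0.le)⟩
  have hD : ∀ h, |f h| ≤ β * Real.log T := fun h => by
    rw [hfdef, abs_of_nonneg (mul_nonneg (mul_nonneg hβ hlog) (hu h).1)]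
    exact mul_le_of_le_one_right (mul_nonneg hβ hlog) (hu h).2
  have hui : ∀ P : Problem n, Integrable (fun h => 1 - plays a h / T) (runLaw P π T) := fun P =>
    (integrable_const _).sub ((integrable_plays P π a T).div_const _)
  have hue : ∀ P : Problem n, ∫ h, (1 - plays a h / T) ∂(runLaw P π T) =
      1 - expectedPlays P π a T / T := fun P => by
    rw [integral_sub (integrable_const _) ((integrable_plays P π a T).div_const _),
      integral_div]
    simp [expectedPlays]
  have key := exp_integral_add_le π hB hg hC hlaw hfm hD
  have h1 : ∫ h, f (observed h) ∂(runLaw B π T) =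
      β * Real.log T * (1 - expectedPlays B π a T / T) := by
    simp only [hfdef, plays_observed]
    rw [integral_const_mul, hue]
  have h2 : ∫ h, ∑ t, g (feedback (h t)) ∂(runLaw B π T) = -K * expectedPlays B π a T := by
    rw [integral_sum_runLaw B π (φ := fun r => g (feedback r)) (hg.comp measurable_feedback)
      (C := C) (fun A _ => ae_of_all _ fun x => hC _) hK, integral_sum_indicator]
  have h3 : ∫ h, Real.exp (f (observed h)) ∂(runLaw B' π T) ≤
      1 + (T : ℝ) ^ β * (1 - expectedPlays B' π a T / T) := by
    have hpt : ∀ h : Fin T → Round n, Real.exp (f (observed h)) ≤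
        1 + (T : ℝ) ^ β * (1 - plays a h / T) := fun h => by
      have e1 : Real.exp (f (observed h)) = ((T : ℝ) ^ β) ^ (1 - plays a h / T) := by
        rw [← Real.rpow_mul hT0.le, Real.rpow_def_of_pos hT0]
        congr 1
        simp only [hfdef, plays_observed]
        ring
      -- Bernoulli's inequality for exponents in `[0, 1]` makes the bound linear in `u`, so that
      -- only the expected plays enter.
      have e2 := rpow_one_add_le_one_add_mul_self (s := (T : ℝ) ^ β - 1)
        (by linarith [Real.rpow_nonneg hT0.le β]) (hu h).1 (hu h).2
      rw [add_sub_cancel] at e2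
      rw [e1]
      nlinarith [(hu h).1]
    calc ∫ h, Real.exp (f (observed h)) ∂(runLaw B' π T)
        ≤ ∫ h, (1 + (T : ℝ) ^ β * (1 - plays a h / T)) ∂(runLaw B' π T) :=
          integral_mono_of_nonneg (ae_of_all _ fun _ => (Real.exp_pos _).le)
            ((integrable_const _).add ((hui B').const_mul _)) (ae_of_all _ hpt)
      _ = 1 + (T : ℝ) ^ β * (1 - expectedPlays B' π a T / T) := by
          rw [integral_add (integrable_const _) ((hui B').const_mul _), integral_const_mul, hue]
          simp
  rw [h1, h2] at key
  have := Real.log_le_log (Real.exp_pos _) (key.trans h3)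
  rw [Real.log_exp] at this
  linarith

/-- A logarithmic lower bound on the number of plays of a suboptimal action `a` whose feedback
distinguishes two problems, if the regret on the first problem is `o(T)`, and the regret on the
second one, where `a` is optimal, is `o(T ^ α)` for all `α > 0`. -/
theorem eventually_mul_log_le_expectedPlays {B B' : Problem n} (π : Policy n)
    (hB : B'.actions = B.actions) {g : Round n → ℝ} (hg : Measurable g) {C : ℝ}
    (hC : ∀ r, |g r| ≤ C)
    (hlaw : ∀ A ∈ B.actions, ∀ G : Round n → ENNReal, Measurable G →
      ∫⁻ x, G (feedback (A, x)) ∂B'.law =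
        ∫⁻ x, G (feedback (A, x)) * ENNReal.ofReal (Real.exp (g (feedback (A, x)))) ∂B.law)
    {a : Action n} (ha : a ∈ B.actions) {K L : ℝ} (hKL : K ≤ L)
    (hK : ∀ A ∈ B.actions, ∫ x, g (feedback (A, x)) ∂B.law = if A = a then -K else 0)
    (hL : 0 < L)
    (hb : ∀ᵐ x ∂B.law, ‖x‖ ≤ 1) (hb' : ∀ᵐ x ∂B'.law, ‖x‖ ≤ 1)
    {Astar : Action n} (hopt : B.IsOptimal Astar) (hsub : B.value a < B.value Astar)
    {γ : ℝ} (hγ : 0 < γ) (hgap : ∀ A ∈ B.actions, A ≠ a → γ ≤ B'.value a - B'.value A)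
    (hR : (fun T : ℕ => regret B π Astar T) =o[atTop] fun T : ℕ => (T : ℝ))
    (hR' : ∀ α : ℝ, 0 < α → (fun T : ℕ => regret B' π a T) =o[atTop] fun T : ℕ => (T : ℝ) ^ α)
    {c : ℝ} (hc : 0 ≤ c) (hcL : c * L < 1) :
    ∀ᶠ T : ℕ in atTop, c * Real.log T ≤ expectedPlays B π a T := by
  -- As `κ < 1`, there is room for `κ < β * (1 - θ)` with `β < 1` and `θ > 0`; the choices below
  -- give a difference of `(1 - κ) * (3 - κ) / 8`.
  set κ := c * L with hκ
  have hκ0 : 0 ≤ κ := mul_nonneg hc hL.le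
  set β := (1 + κ) / 2 with hβ
  set θ := (1 - κ) / 4 with hθ
  have hβ0 : 0 ≤ β := by rw [hβ]; linarith
  have hβ1 : 0 < 1 - β := by rw [hβ]; linarith
  have hθ0 : 0 < θ := by rw [hθ]; linarith
  have hβθ : 0 < β * (1 - θ) - κ := by
    rw [hβ, hθ]
    nlinarith
  have hgap0 : 0 < B.value Astar - B.value a := sub_pos.2 hsub
  have hlogt : Tendsto (fun T : ℕ => Real.log T) atTop atTop :=
    Real.tendsto_log_atTop.comp tendsto_natCast_atTop_atTop
  -- On the first problem `a` takes at most a fraction `θ` of the rounds; on the second, at most `T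
  -- ^ (1 - β)` rounds miss `a`. The last condition lets `log T` absorb the `log 2` on the
  -- right-hand side.
  filter_upwards [eventually_gt_atTop 0, hR.bound (mul_pos hθ0 hgap0), (hR' _ hβ1).bound hγ,
    hlogt.eventually_ge_atTop (Real.log 2 / (β * (1 - θ) - κ))] with T hT h1 h2 h3
  have hT0 : (0 : ℝ) < T := by exact_mod_cast hT
  have hlog : 0 ≤ Real.log T := Real.log_nonneg (by exact_mod_cast hT)
  have hN := expectedPlays_nonneg B π a T
  have hfrac : expectedPlays B π a T / T ≤ θ := by
    rw [div_le_iff₀ hT0]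
    have e1 : (B.value Astar - B.value a) * expectedPlays B π a T ≤ regret B π Astar T := by
      rw [regret_eq_sum hb]
      exact Finset.single_le_sum
        (f := fun A => (B.value Astar - B.value A) * expectedPlays B π A T)
        (fun A hA => mul_nonneg (sub_nonneg.2 (hopt.2 A hA)) (expectedPlays_nonneg B π A T)) ha
    have e2 := (le_abs_self _).trans h1
    rw [Real.norm_of_nonneg hT0.le] at e2
    have e3 : (B.value Astar - B.value a) * expectedPlays B π a T ≤
        (B.value Astar - B.value a) * (θ * T) := by linarith
    exact le_of_mul_le_mul_left e3 hgap0
  have hrare : (T : ℝ) ^ β * (1 - expectedPlays B' π a T / T) ≤ 1 := by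
    have e1 := mul_sub_expectedPlays_le_regret hb' π (hB ▸ ha)
      (fun A hA => hgap A (hB ▸ hA)) T
    have e2 := (le_abs_self _).trans h2
    rw [Real.norm_of_nonneg (Real.rpow_nonneg hT0.le _)] at e2
    have e3 : (T : ℝ) - expectedPlays B' π a T ≤ (T : ℝ) ^ (1 - β) :=
      le_of_mul_le_mul_left (e1.trans e2) hγ
    have e4 : 1 - expectedPlays B' π a T / T = (T - expectedPlays B' π a T) / T := by
      field_simp
    rw [e4, ← mul_div_assoc, div_le_one hT0]
    calc (T : ℝ) ^ β * (T - expectedPlays B' π a T)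
        ≤ (T : ℝ) ^ β * (T : ℝ) ^ (1 - β) :=
          mul_le_mul_of_nonneg_left e3 (Real.rpow_nonneg hT0.le _)
      _ = T := by rw [← Real.rpow_add hT0]; simp
  have hrare0 : 0 ≤ (T : ℝ) ^ β * (1 - expectedPlays B' π a T / T) :=
    mul_nonneg (Real.rpow_nonneg hT0.le _)
      (sub_nonneg.2 ((div_le_one hT0).2 (expectedPlays_le B' π a T)))
  have key := le_log_one_add_of_change π hB hg hC hlaw hK hT hβ0
  have hlog2 : Real.log (1 + (T : ℝ) ^ β * (1 - expectedPlays B' π a T / T)) ≤ Real.log 2 :=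
    Real.log_le_log (by linarith) (by linarith)
  have e5 : β * Real.log T * (1 - θ) ≤ β * Real.log T * (1 - expectedPlays B π a T / T) :=
    mul_le_mul_of_nonneg_left (by linarith) (mul_nonneg hβ0 hlog)
  rw [div_le_iff₀ hβθ] at h3
  have e6 : K * expectedPlays B π a T ≤ L * expectedPlays B π a T :=
    mul_le_mul_of_nonneg_right hKL hN
  have e7 : L * (c * Real.log T) ≤ L * expectedPlays B π a T := by
    have : L * (c * Real.log T) = κ * Real.log T := by rw [hκ]; ring
    rw [this]
    linarith
  exact le_of_mul_le_mul_left e7 hL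

/-! ### Sparse random sets with prescribed marginals. -/

/-- A random set of at most `k` elements of `Fin k × Fin M` with prescribed marginals: with
probability `p` each, one of the `M` fibres of the second projection, and with probability `d j` the
singleton of `j`. -/
theorem exists_measure_finset (k M : ℕ) (hk : 0 < k) {p : ℝ} (hp : 0 ≤ p)
    {d : Fin k × Fin M → ℝ} (hd : ∀ j, 0 ≤ d j) (hsum : M * p + ∑ j, d j ≤ 1) :
    ∃ ρ : Measure (Finset (Fin k × Fin M)), IsProbabilityMeasure ρ ∧
      (∀ᵐ W ∂ρ, W.card ≤ k) ∧ ∀ j, ρ {W | j ∈ W} = ENNReal.ofReal (p + d j) := by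
  -- The fibres partition the index set into sets of size `k`, so each `j` receives `p` exactly
  -- once; the leftover mass sits on `∅`.
  let ρ : Measure (Finset (Fin k × Fin M)) :=
    ∑ r : Fin M, ENNReal.ofReal p • Measure.dirac (Finset.univ ×ˢ {r}) +
      ∑ j, ENNReal.ofReal (d j) • Measure.dirac {j} +
      ENNReal.ofReal (1 - (M * p + ∑ j, d j)) • Measure.dirac ∅
  have happ : ∀ S : Set (Finset (Fin k × Fin M)), ρ S =
      ∑ r : Fin M, ENNReal.ofReal p * S.indicator 1 (Finset.univ ×ˢ {r}) +
      ∑ j, ENNReal.ofReal (d j) * S.indicator 1 {j} +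
      ENNReal.ofReal (1 - (M * p + ∑ j, d j)) * S.indicator 1 ∅ := fun S => by
    simp [ρ]
  refine ⟨ρ, ⟨?_⟩, ?_, fun j => ?_⟩
  · rw [happ]
    simp only [Set.indicator_univ, Pi.one_apply, mul_one]
    rw [← ENNReal.ofReal_sum_of_nonneg fun j _ => hd j, Finset.sum_const, Finset.card_univ,
      Fintype.card_fin, nsmul_eq_mul, ← ENNReal.ofReal_natCast,
      ← ENNReal.ofReal_mul (Nat.cast_nonneg _),
      ← ENNReal.ofReal_add (by positivity) (Finset.sum_nonneg fun j _ => hd j),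
      ← ENNReal.ofReal_add (add_nonneg (by positivity) (Finset.sum_nonneg fun j _ => hd j))
        (by linarith)]
    simp
  · rw [ae_iff, happ]
    simp [Set.indicator_apply]
    omega
  · rw [happ, ENNReal.ofReal_add hp (hd j)]
    simp only [Set.indicator_apply, Set.mem_ofPred_eq, Finset.mem_product, Finset.mem_univ,
      true_and, Finset.mem_singleton, Finset.notMem_empty, if_false, Pi.one_apply, mul_ite,
      mul_one, mul_zero, Finset.sum_ite_eq, if_true, add_zero]

/-! ### Problems built from blocks of arms. -/

variable {m : ℕ} {J : Type*} [DecidableEq J]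

/-- The `j`-th block of arms. -/
def block (e : Fin n ≃ J × Fin m) (j : J) : Action n :=
  Finset.univ.filter fun i => (e i).1 = j

/-- The vector that is `1` on the first `b` arms of the blocks in `W`, and `0` elsewhere. -/
def blockVec (e : Fin n ≃ J × Fin m) (b : ℕ) (W : Finset J) : Fin n → ℝ :=
  fun i => if (e i).1 ∈ W ∧ (e i).2.val < b then 1 else 0

theorem card_filter_block (e : Fin n ≃ J × Fin m) {b : ℕ} (hb : b ≤ m) (W : Finset J) :
    (Finset.univ.filter fun i => (e i).1 ∈ W ∧ (e i).2.val < b).card = W.card * b := by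
  have h1 : (Finset.univ.filter fun i => (e i).1 ∈ W ∧ (e i).2.val < b).map e.toEmbedding =
      W ×ˢ (Finset.univ.filter fun u : Fin m => u.val < b) := by
    ext ⟨j, u⟩
    simp
  rw [← Finset.card_map e.toEmbedding, h1, Finset.card_product]
  congr 1
  simp [Fin.card_filter_val_lt, hb]

theorem card_block (e : Fin n ≃ J × Fin m) (j : J) : (block e j).card = m := by
  have h := card_filter_block e le_rfl {j}
  simpa [block] using h

theorem block_injective (e : Fin n ≃ J × Fin m) (hm : 0 < m) :
    Function.Injective (block e) := fun j j' h => by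
  have : e.symm (j, ⟨0, hm⟩) ∈ block e j := by simp [block]
  rw [h] at this
  simpa [block] using this

/-- The feedback depends on `W` only through the bit `j ∈ W`, so the dependence between blocks is
invisible and the marginals determine all feedback laws. -/
theorem feedback_blockVec (e : Fin n ≃ J × Fin m) (b : ℕ) (j : J) (W : Finset J) :
    feedback (block e j, blockVec e b W) =
      (block e j, if j ∈ W then blockVec e b {j} else 0) := by
  refine Prod.ext rfl (funext fun i => ?_)
  by_cases hi : (e i).1 = j
  · by_cases hj : j ∈ W <;> simp [feedback, block, blockVec, hi, hj]
  · by_cases hj : j ∈ W <;> simp [feedback, block, blockVec, hi, hj]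

theorem norm_blockVec_le (e : Fin n ≃ J × Fin m) (b : ℕ) (W : Finset J) :
    ‖blockVec e b W‖ ≤ 1 := by
  refine (pi_norm_le_iff_of_nonneg zero_le_one).2 fun i => ?_
  unfold blockVec
  split_ifs <;> simp

section

variable [Fintype J] (ρ : Measure (Finset J)) [IsProbabilityMeasure ρ] {q : J → ℝ}

theorem integral_ite_mem (hq : ∀ j, ρ {W | j ∈ W} = ENNReal.ofReal (q j)) {j : J}
    (hq0 : 0 ≤ q j) (c c' : ℝ) :
    ∫ W, (if j ∈ W then c else c') ∂ρ = q j * c + (1 - q j) * c' := by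
  have h : (fun W : Finset J => if j ∈ W then c else c') =
      fun W => ({W | j ∈ W} : Set (Finset J)).indicator (fun _ => c - c') W + c' := by
    funext W
    by_cases hj : j ∈ W <;> simp [hj]
  rw [h, integral_add .of_finite (integrable_const _),
    integral_indicator_const _ MeasurableSet.of_discrete, Measure.real, hq, ENNReal.toReal_ofReal hq0]
  simp
  ring

theorem lintegral_ite_mem (hq : ∀ j, ρ {W | j ∈ W} = ENNReal.ofReal (q j)) {j : J}
    (hq0 : 0 ≤ q j) (c c' : ENNReal) :
    ∫⁻ W, (if j ∈ W then c else c') ∂ρ =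
      ENNReal.ofReal (q j) * c + ENNReal.ofReal (1 - q j) * c' := by
  have hc : ρ {W | j ∈ W}ᶜ = ENNReal.ofReal (1 - q j) := by
    rw [prob_compl_eq_one_sub MeasurableSet.of_discrete, hq,
      ENNReal.ofReal_sub _ hq0, ENNReal.ofReal_one]
  have h : (fun W : Finset J => if j ∈ W then c else c') =
      fun W => ({W | j ∈ W} : Set (Finset J)).indicator (fun _ => c) W +
        ({W | j ∈ W}ᶜ : Set (Finset J)).indicator (fun _ => c') W := by
    funext W
    by_cases hj : j ∈ W <;> simp [hj]
  rw [h, lintegral_add_left (measurable_of_finite _),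
    lintegral_indicator_const MeasurableSet.of_discrete,
    lintegral_indicator_const MeasurableSet.of_discrete, hq, hc, mul_comm c, mul_comm c']

end

/-- The problem whose actions are the blocks, and whose outcome vector is `blockVec e b W` for a
random set `W` of blocks. -/
noncomputable def blockProblem [Fintype J] [Nonempty J] (e : Fin n ≃ J × Fin m) (b : ℕ)
    (ρ : Measure (Finset J)) [IsProbabilityMeasure ρ] : Problem n where
  actions := Finset.univ.image (block e)
  nonempty := Finset.univ_nonempty.image _
  law := ρ.map (blockVec e b)
  isProb := Measure.isProbabilityMeasure_map (measurable_of_finite _).aemeasurable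

section

variable [Fintype J] [Nonempty J] (e : Fin n ≃ J × Fin m) (b : ℕ) (ρ : Measure (Finset J))
  [IsProbabilityMeasure ρ] {q : J → ℝ}

theorem lintegral_feedback_block (hq : ∀ j, ρ {W | j ∈ W} = ENNReal.ofReal (q j)) {j : J}
    (hq0 : 0 ≤ q j) {G : Round n → ENNReal} (hG : Measurable G) :
    ∫⁻ x, G (feedback (block e j, x)) ∂(blockProblem e b ρ).law =
      ENNReal.ofReal (q j) * G (block e j, blockVec e b {j}) +
        ENNReal.ofReal (1 - q j) * G (block e j, 0) := by
  have hm : Measurable fun x => G (feedback (block e j, x)) :=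
    hG.comp (measurable_feedback.comp measurable_prodMk_left)
  rw [← lintegral_ite_mem ρ hq hq0]
  refine (lintegral_map hm (measurable_of_finite _)).trans (lintegral_congr fun W => ?_)
  rw [feedback_blockVec]
  split_ifs <;> rfl

theorem integral_feedback_block (hq : ∀ j, ρ {W | j ∈ W} = ENNReal.ofReal (q j)) {j : J}
    (hq0 : 0 ≤ q j) {g : Round n → ℝ} (hg : Measurable g) :
    ∫ x, g (feedback (block e j, x)) ∂(blockProblem e b ρ).law =
      q j * g (block e j, blockVec e b {j}) + (1 - q j) * g (block e j, 0) := by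
  have hm : Measurable fun x => g (feedback (block e j, x)) :=
    hg.comp (measurable_feedback.comp measurable_prodMk_left)
  rw [← integral_ite_mem ρ hq hq0]
  refine (integral_map (measurable_of_finite _).aemeasurable hm.aestronglyMeasurable).trans
    (integral_congr_ae (ae_of_all _ fun W => ?_))
  simp only
  rw [feedback_blockVec]
  split_ifs <;> rfl

theorem mean_blockProblem (hq : ∀ j, ρ {W | j ∈ W} = ENNReal.ofReal (q j))
    (hq0 : ∀ j, 0 ≤ q j) (i : Fin n) :
    (blockProblem e b ρ).mean i = if (e i).2.val < b then q (e i).1 else 0 := by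
  have h : (blockProblem e b ρ).mean i = ∫ W, blockVec e b W i ∂ρ :=
    integral_map (measurable_of_finite _).aemeasurable
      (measurable_pi_apply i).aestronglyMeasurable
  rw [h]
  by_cases hi : (e i).2.val < b
  · have := integral_ite_mem ρ hq (hq0 (e i).1) 1 0
    simpa [blockVec, hi] using this
  · simp [blockVec, hi]

theorem value_blockProblem (hb : b ≤ m) (hq : ∀ j, ρ {W | j ∈ W} = ENNReal.ofReal (q j))
    (hq0 : ∀ j, 0 ≤ q j) (j : J) :
    (blockProblem e b ρ).value (block e j) = b * q j := by
  have h : ∀ i ∈ block e j, (blockProblem e b ρ).mean i =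
      if (e i).2.val < b then q j else 0 := fun i hi => by
    rw [mean_blockProblem e b ρ hq hq0]
    simp only [block, Finset.mem_filter, Finset.mem_univ, true_and] at hi
    rw [hi]
  rw [Problem.value, Finset.sum_congr rfl h, ← Finset.sum_filter, block, Finset.filter_filter,
    Finset.sum_const, nsmul_eq_mul]
  have := card_filter_block e hb {j}
  simp only [Finset.mem_singleton, Finset.card_singleton, one_mul] at this
  rw [this]

theorem bounded_blockProblem : ∀ᵐ x ∂(blockProblem e b ρ).law, ‖x‖ ≤ 1 := by
  have hS : MeasurableSet {x : Fin n → ℝ | ‖x‖ ≤ 1} :=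
    measurableSet_le measurable_norm measurable_const
  exact (ae_map_iff (measurable_of_finite _).aemeasurable hS).2
    (ae_of_all _ fun W => norm_blockVec_le e b W)

theorem isSparse_blockProblem (hb : b ≤ m) {k s : ℕ} (hk : ∀ᵐ W ∂ρ, W.card ≤ k)
    (hs : k * b = s) : (blockProblem e b ρ).IsSparse m s := by
  refine ⟨?_, bounded_blockProblem e b ρ, ?_⟩
  · apply le_antisymm
    · refine Finset.sup_le fun A hA => ?_
      obtain ⟨j, -, rfl⟩ := Finset.mem_image.1 hA
      rw [card_block]
    · obtain ⟨j⟩ := ‹Nonempty J›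
      calc m = (block e j).card := (card_block e j).symm
        _ ≤ _ := Finset.le_sup (f := Finset.card)
          (Finset.mem_image_of_mem _ (Finset.mem_univ j))
  · have hm : Measurable fun x : Fin n → ℝ => (Finset.univ.filter fun i => x i ≠ 0) := by
      refine measurable_to_countable' fun S => ?_
      have : (fun x : Fin n → ℝ => (Finset.univ.filter fun i => x i ≠ 0)) ⁻¹' {S} =
          ⋂ i, {x | x i ≠ 0 ↔ i ∈ S} := by
        ext x
        simp [Finset.ext_iff]
      rw [this]
      refine MeasurableSet.iInter fun i => ?_
      have h0 : MeasurableSet {x : Fin n → ℝ | x i = 0} :=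
        measurableSet_eq_fun (measurable_pi_apply i) measurable_const
      by_cases hi : i ∈ S
      · have h1 : {x : Fin n → ℝ | x i ≠ 0 ↔ i ∈ S} = {x | x i = 0}ᶜ := by
          ext x
          simp [hi]
        rw [h1]
        exact h0.compl
      · simpa [hi] using h0
    have hS : MeasurableSet {x : Fin n → ℝ | (Finset.univ.filter fun i => x i ≠ 0).card ≤ s} :=
      hm (MeasurableSet.of_discrete (s := {S : Finset (Fin n) | S.card ≤ s}))
    refine (ae_map_iff (measurable_of_finite _).aemeasurable hS).2 ?_
    filter_upwards [hk] with W hW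
    calc (Finset.univ.filter fun i => blockVec e b W i ≠ 0).card
        = W.card * b := by
          rw [← card_filter_block e hb W]
          congr 1
          ext i
          simp [blockVec]
      _ ≤ s := hs ▸ Nat.mul_le_mul_right b hW

end

/-! ### The hard problem and its alternatives. -/

/-- The relative entropy of two Bernoulli laws is at most their `χ²` divergence. -/
theorem bernoulli_log_ratio_ge {p r : ℝ} (hp0 : 0 < p) (hp1 : p < 1) (hr0 : 0 < r) (hr1 : r < 1) :
    -((r - p) ^ 2 / (r * (1 - r))) ≤
      p * Real.log (r / p) + (1 - p) * Real.log ((1 - r) / (1 - p)) := by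
  have hp1' : 0 < 1 - p := sub_pos.2 hp1
  have hr1' : 0 < 1 - r := sub_pos.2 hr1
  have h1 : -Real.log (r / p) ≤ p / r - 1 := by
    rw [← Real.log_inv, inv_div]
    exact Real.log_le_sub_one_of_pos (div_pos hp0 hr0)
  have h2 : -Real.log ((1 - r) / (1 - p)) ≤ (1 - p) / (1 - r) - 1 := by
    rw [← Real.log_inv, inv_div]
    exact Real.log_le_sub_one_of_pos (div_pos hp1' hr1')
  have h3 : p * (p / r - 1) + (1 - p) * ((1 - p) / (1 - r) - 1) = (r - p) ^ 2 / (r * (1 - r)) := by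
    have := hr0.ne'
    have := hr1'.ne'
    field_simp
    ring
  rw [← h3]
  nlinarith [mul_le_mul_of_nonneg_left h1 hp0.le, mul_le_mul_of_nonneg_left h2 hp1'.le]

/-- The two random sets may differ as joint laws; it suffices that their marginals agree off `a`,
since then the feedback of every other block has the same law in both problems. -/
theorem eventually_le_expectedPlays_block [Fintype J] [Nonempty J] (hm : 0 < m)
    (e : Fin n ≃ J × Fin m) {b : ℕ} (hb0 : 0 < b) (hb : b ≤ m) {k : ℕ}
    {ρ ρ' : Measure (Finset J)} [IsProbabilityMeasure ρ] [IsProbabilityMeasure ρ']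
    (hk : ∀ᵐ W ∂ρ, W.card ≤ k) (hk' : ∀ᵐ W ∂ρ', W.card ≤ k) {q q' : J → ℝ}
    (hq : ∀ j, ρ {W | j ∈ W} = ENNReal.ofReal (q j))
    (hq' : ∀ j, ρ' {W | j ∈ W} = ENNReal.ofReal (q' j))
    (hq0 : ∀ j, 0 ≤ q j) (hq'0 : ∀ j, 0 ≤ q' j)
    {a js : J} (hopt : ∀ j, q j ≤ q js) (hsub : q a < q js)
    (heq : ∀ j, j ≠ a → q' j = q j) {γ : ℝ} (hγ : 0 < γ) (hgap : ∀ j, j ≠ a → q' j + γ ≤ q' a)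
    (ha0 : 0 < q a) (haa : q a < q' a) (ha1 : q' a < 1)
    {c : ℝ} (hc : 0 ≤ c) (hcq : c * (q' a - q a) ^ 2 < q' a * (1 - q' a))
    (π : Policy n) (hπ : π.IsConsistent m (k * b)) :
    ∀ᶠ T : ℕ in atTop,
      c * Real.log T ≤ expectedPlays (blockProblem e b ρ) π (block e a) T := by
  have ha0' : 0 < q' a := ha0.trans haa
  have ha1' : q a < 1 := haa.trans ha1
  have hbR : (0 : ℝ) < b := by exact_mod_cast hb0
  have hval := value_blockProblem e b ρ hb hq hq0
  have hval' := value_blockProblem e b ρ' hb hq' hq'0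
  let i₀ : Fin n := e.symm (a, ⟨0, hm⟩)
  let l₁ := Real.log (q' a / q a)
  let l₀ := Real.log ((1 - q' a) / (1 - q a))
  -- Log-likelihood ratio of the two Bernoulli bits, read off at the first arm of block `a`, which
  -- is active exactly when `a ∈ W` because `0 < b`.
  let g : Round n → ℝ := fun r => if r.1 = block e a then (if r.2 i₀ = 1 then l₁ else l₀) else 0
  have hg : Measurable g := by
    refine Measurable.ite (measurable_fst (MeasurableSet.singleton (block e a))) ?_
      measurable_const
    refine Measurable.ite ?_ measurable_const measurable_const
    exact measurableSet_eq_fun ((measurable_pi_apply i₀).comp measurable_snd) measurable_const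
  have hgC : ∀ r, |g r| ≤ |l₁| + |l₀| := fun r => by
    simp only [g]
    split_ifs <;> simp [abs_nonneg, add_nonneg]
  have hg1 : g (block e a, blockVec e b {a}) = l₁ := by
    simp [g, i₀, blockVec, hb0]
  have hg0 : g (block e a, 0) = l₀ := by simp [g]
  have hgne : ∀ j, j ≠ a → ∀ x, g (block e j, x) = 0 := fun j hj x => by
    simp [g, (block_injective e hm).ne hj]
  have hopt' : (blockProblem e b ρ).IsOptimal (block e js) := by
    refine ⟨Finset.mem_image_of_mem _ (Finset.mem_univ _), fun A hA => ?_⟩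
    obtain ⟨j, -, rfl⟩ := Finset.mem_image.1 hA
    rw [hval, hval]
    exact mul_le_mul_of_nonneg_left (hopt j) hbR.le
  have hgap' : ∀ A ∈ (blockProblem e b ρ).actions, A ≠ block e a →
      b * γ ≤ (blockProblem e b ρ').value (block e a) - (blockProblem e b ρ').value A := by
    intro A hA hne
    obtain ⟨j, -, rfl⟩ := Finset.mem_image.1 hA
    have hj : j ≠ a := fun h => hne (h ▸ rfl)
    rw [hval', hval', ← mul_sub]
    exact mul_le_mul_of_nonneg_left (by linarith [hgap j hj]) hbR.le
  have hopta : (blockProblem e b ρ').IsOptimal (block e a) := by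
    refine ⟨Finset.mem_image_of_mem _ (Finset.mem_univ _), fun A hA => ?_⟩
    by_cases h : A = block e a
    · rw [h]
    · linarith [hgap' A hA h, mul_pos hbR hγ]
  refine eventually_mul_log_le_expectedPlays (B := blockProblem e b ρ)
    (B' := blockProblem e b ρ') π rfl hg hgC ?_
    (Finset.mem_image_of_mem _ (Finset.mem_univ _))
    -- `K` is the relative entropy of the bit of `a`, and `L` its `χ²` upper bound.
    (K := -(q a * l₁ + (1 - q a) * l₀))
    (L := (q' a - q a) ^ 2 / (q' a * (1 - q' a))) ?_ ?_ ?_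
    (bounded_blockProblem e b ρ) (bounded_blockProblem e b ρ') hopt' ?_ (mul_pos hbR hγ) hgap'
    ?_ ?_ hc ?_
  · intro A hA G hG
    obtain ⟨j, -, rfl⟩ := Finset.mem_image.1 hA
    rw [lintegral_feedback_block e b ρ' hq' (hq'0 j) hG,
      lintegral_feedback_block e b ρ hq (hq0 j)
        (G := fun r => G r * ENNReal.ofReal (Real.exp (g r)))
        (hG.mul (ENNReal.measurable_ofReal.comp (Real.measurable_exp.comp hg)))]
    by_cases hj : j = a
    · subst hj
      have h1 : ENNReal.ofReal (q' j) = ENNReal.ofReal (q j) * ENNReal.ofReal (Real.exp l₁) := by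
        rw [← ENNReal.ofReal_mul ha0.le, Real.exp_log (div_pos ha0' ha0),
          mul_div_cancel₀ _ ha0.ne']
      have h0 : ENNReal.ofReal (1 - q' j) =
          ENNReal.ofReal (1 - q j) * ENNReal.ofReal (Real.exp l₀) := by
        rw [← ENNReal.ofReal_mul (sub_pos.2 ha1').le,
          Real.exp_log (div_pos (sub_pos.2 ha1) (sub_pos.2 ha1')),
          mul_div_cancel₀ _ (sub_pos.2 ha1').ne']
      rw [hg1, hg0, h1, h0]
      ring
    · simp [hgne j hj, heq j hj]
  · have := bernoulli_log_ratio_ge ha0 ha1' ha0' ha1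
    linarith
  · intro A hA
    obtain ⟨j, -, rfl⟩ := Finset.mem_image.1 hA
    rw [integral_feedback_block e b ρ hq (hq0 j) hg]
    by_cases hj : j = a
    · subst hj
      rw [hg1, hg0, if_pos rfl, neg_neg]
    · rw [hgne j hj, hgne j hj, if_neg ((block_injective e hm).ne hj)]
      ring
  · exact div_pos (pow_pos (sub_pos.2 haa) 2) (mul_pos ha0' (sub_pos.2 ha1))
  · rw [hval, hval]
    exact mul_lt_mul_of_pos_left hsub hbR
  · have := hπ _ (isSparse_blockProblem e b ρ hb hk rfl) _ hopt' 1 one_pos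
    simpa using this
  · exact hπ _ (isSparse_blockProblem e b ρ' hb hk' rfl) _ hopta
  · rw [← mul_div_assoc, div_lt_one (mul_pos ha0' (sub_pos.2 ha1))]
    exact hcq

/-- Raising the marginal of `a` by exactly `δ` would only tie it with the optimum. Both conditions
are strict and continuous at `ε = 0`, so they survive a small `ε > 0`, which makes `a` strictly
optimal. -/
theorem exists_perturbation {p δ c x : ℝ} (h1 : x + 2 * δ < 1)
    (h2 : c * δ ^ 2 < (p + δ) * (1 - (p + δ))) :
    ∃ ε : ℝ, 0 < ε ∧ x + (δ + (δ + ε)) ≤ 1 ∧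
      c * (δ + ε) ^ 2 < (p + (δ + ε)) * (1 - (p + (δ + ε))) := by
  have hA : ∀ᶠ ε : ℝ in nhds 0, x + (δ + (δ + ε)) < 1 :=
    ContinuousAt.eventually_lt (by fun_prop) (by fun_prop) (by simpa using by linarith)
  have hB : ∀ᶠ ε : ℝ in nhds 0, c * (δ + ε) ^ 2 < (p + (δ + ε)) * (1 - (p + (δ + ε))) :=
    ContinuousAt.eventually_lt (by fun_prop) (by fun_prop) (by simpa using h2)
  have hC : ∀ᶠ ε : ℝ in nhdsWithin 0 (Set.Ioi 0), 0 < ε := self_mem_nhdsWithin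
  obtain ⟨ε, h, h', h''⟩ :=
    (hC.and ((hA.filter_mono nhdsWithin_le_nhds).and (hB.filter_mono nhdsWithin_le_nhds))).exists
  exact ⟨ε, h, h'.le, h''⟩

theorem exists_hard_problem {k M b : ℕ} (hk : 0 < k) (hM : 2 ≤ M) (hb0 : 0 < b) (hb : b ≤ m)
    (hn : n = k * M * m) {δ : ℝ} (hδ : 0 < δ) (hδ' : δ ≤ k / (2 * (k * M - 1)))
    (π : Policy n) (hπ : π.IsConsistent m (k * b)) :
    ∃ B : Problem n, B.IsSparse m (k * b) ∧
      ∃ Astar, B.IsOptimal Astar ∧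
        (∃ A ∈ B.actions, A ≠ Astar) ∧
        (∀ A ∈ B.actions, A ≠ Astar → B.value Astar - B.value A = b * δ) ∧
        ∀ᶠ T : ℕ in atTop, (k * b * b * (1 - 2 / (k * M)) / 4 : ℝ) ≤
          b * δ / Real.log T * regret B π Astar T := by
  have hm : 0 < m := hb0.trans_le hb
  have hkR : (1 : ℝ) ≤ k := by exact_mod_cast hk
  have hMR : (2 : ℝ) ≤ M := by exact_mod_cast hM
  have hbR : (0 : ℝ) < b := by exact_mod_cast hb0
  have hkM : (2 : ℝ) ≤ k * M := by nlinarith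
  have hkM1 : (0 : ℝ) < k * M - 1 := by linarith
  rw [le_div_iff₀ (by positivity)] at hδ'
  have hδ2 : 2 * δ ≤ 1 := by nlinarith
  let e : Fin n ≃ (Fin k × Fin M) × Fin m := Fintype.equivOfCardEq (by simp [hn])
  -- Chosen so that `M * p + δ = 1 / 2`: the hard problem uses half of the mass, and the other half
  -- leaves room for the extra `δ + ε` of an alternative.
  set p : ℝ := (1 - 2 * δ) / (2 * M) with hp
  have hp0 : 0 ≤ p := div_nonneg (by linarith) (by positivity)
  have hMp : M * p = 1 / 2 - δ := by
    rw [hp]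
    field_simp
  let js : Fin k × Fin M := (⟨0, hk⟩, ⟨0, by omega⟩)
  let j₁ : Fin k × Fin M := (⟨0, hk⟩, ⟨1, by omega⟩)
  have hj₁ : j₁ ≠ js := by simp [j₁, js]
  have : Nonempty (Fin k × Fin M) := ⟨js⟩
  let d : Fin k × Fin M → ℝ := Pi.single js δ
  have hd0 : ∀ j, 0 ≤ d j := fun j => by
    by_cases h : j = js
    · rw [h]; simp [d, hδ.le]
    · simp [d, h]
  have hdsum : ∑ j, d j = δ := by simp [d]
  have hdjs : d js = δ := by simp [d]
  have hdne : ∀ j, j ≠ js → d j = 0 := fun j hj => by simp [d, hj]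
  obtain ⟨ρ, hρ, hρk, hρq⟩ := exists_measure_finset k M hk hp0 hd0 (by rw [hMp, hdsum]; linarith)
  have hq0 : ∀ j, 0 ≤ p + d j := fun j => add_nonneg hp0 (hd0 j)
  have hval := value_blockProblem e b ρ hb hρq hq0
  have hgapval : ∀ A ∈ (blockProblem e b ρ).actions, A ≠ block e js →
      (blockProblem e b ρ).value (block e js) - (blockProblem e b ρ).value A = b * δ := by
    intro A hA hne
    obtain ⟨j, -, rfl⟩ := Finset.mem_image.1 hA
    have hj : j ≠ js := fun h => hne (h ▸ rfl)
    rw [hval, hval, hdjs, hdne j hj]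
    ring
  have hopt : (blockProblem e b ρ).IsOptimal (block e js) := by
    refine ⟨Finset.mem_image_of_mem _ (Finset.mem_univ _), fun A hA => ?_⟩
    by_cases h : A = block e js
    · rw [h]
    · linarith [hgapval A hA h, mul_pos hbR hδ]
  refine ⟨blockProblem e b ρ, isSparse_blockProblem e b ρ hb hρk rfl, block e js, hopt,
    ⟨block e j₁, Finset.mem_image_of_mem _ (Finset.mem_univ _), (block_injective e hm).ne hj₁⟩,
    hgapval, ?_⟩
  have hbdd := bounded_blockProblem e b ρ
  -- With two blocks the claimed bound is zero, and `p` may vanish, which would spoil the likelihood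
  -- ratio. Otherwise `k + 2 ≤ k * M` forces `δ < 1 / 2`, hence `p > 0`.
  by_cases hN : k * M = 2
  · have hN' : (k : ℝ) * M = 2 := by exact_mod_cast hN
    filter_upwards [eventually_gt_atTop 0] with T hT
    have hlog : 0 ≤ Real.log T := Real.log_nonneg (by exact_mod_cast hT)
    rw [hN']
    norm_num
    exact mul_nonneg (by positivity) (regret_nonneg hbdd π hopt T)
  · have hN3 : k + 2 ≤ k * M := by
      rcases Nat.lt_or_ge k 2 with h | h
      · obtain rfl : k = 1 := by omega
        omega
      · nlinarith
    have hN3R : (k : ℝ) + 2 ≤ k * M := by exact_mod_cast hN3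
    have hδlt : 2 * δ < 1 := by nlinarith
    have hp0' : 0 < p := div_pos (by linarith) (by positivity)
    -- The value for which `(b * δ) ^ 2 * (k * M - 1) * c` is exactly the target constant.
    set c : ℝ := k * (k * M - 2) / (4 * (k * M) * (k * M - 1) * δ ^ 2) with hc
    have hc0 : 0 ≤ c :=
      div_nonneg (mul_nonneg (by positivity) (by linarith)) (by positivity)
    -- As `p + δ` lies in `[1 / (2 * M), 1 / 2]`, the right side is at least `1 / (4 * M)`; the
    -- factor `(k * M - 2) / (k * M - 1)` in `c` makes the inequality strict, as the perturbation
    -- requires.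
    have hcδ : c * δ ^ 2 < (p + δ) * (1 - (p + δ)) := by
      have h1 : c * δ ^ 2 = (k * M - 2) / (k * M - 1) * (1 / (4 * M)) := by
        rw [hc]
        field_simp
      have h2 : ((k : ℝ) * M - 2) / (k * M - 1) < 1 := (div_lt_one hkM1).2 (by linarith)
      have h3 : 1 / (2 * M) ≤ p + δ := by
        rw [div_le_iff₀ (by positivity)]
        nlinarith
      have h4 : p + δ ≤ 1 / 2 := by nlinarith
      have h5 : (0 : ℝ) < 1 / (2 * M) := by positivity
      have h6 : (1 : ℝ) / (4 * M) = 1 / (2 * M) * (1 / 2) := by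
        field_simp
        norm_num
      calc c * δ ^ 2 < 1 * (1 / (4 * M)) := by
            rw [h1]
            exact mul_lt_mul_of_pos_right h2 (by positivity)
        _ = 1 / (2 * M) * (1 / 2) := by rw [one_mul, h6]
        _ ≤ (p + δ) * (1 - (p + δ)) := by
          apply mul_le_mul h3 (by linarith) (by norm_num) (by linarith)
    obtain ⟨ε, hε, hε1, hε2⟩ := exists_perturbation (x := M * p) (by linarith) hcδ
    have hplays : ∀ a, a ≠ js → ∀ᶠ T : ℕ in atTop,
        c * Real.log T ≤ expectedPlays (blockProblem e b ρ) π (block e a) T := by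
      intro a ha
      let d' : Fin k × Fin M → ℝ := d + Pi.single a (δ + ε)
      have hda : d' a = δ + ε := by simp [d', hdne a ha]
      have hdne' : ∀ j, j ≠ a → d' j = d j := fun j hj => by simp [d', hj]
      have hd'0 : ∀ j, 0 ≤ d' j := fun j => by
        by_cases h : j = a
        · rw [h, hda]; positivity
        · rw [hdne' j h]; exact hd0 j
      have hd'sum : ∑ j, d' j = δ + (δ + ε) := by
        simp only [d', Pi.add_apply, Finset.sum_add_distrib, hdsum]
        simp
      obtain ⟨ρ', hρ', hρk', hρq'⟩ := exists_measure_finset k M hk hp0 hd'0 (by rwa [hd'sum])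
      have hdle : ∀ j, d j ≤ δ := fun j => by
        by_cases h : j = js
        · rw [h, hdjs]
        · rw [hdne j h]; exact hδ.le
      refine eventually_le_expectedPlays_block hm e hb0 hb hρk hρk' hρq hρq' hq0
        (fun j => add_nonneg hp0 (hd'0 j)) (a := a) (js := js) ?_ ?_ ?_ hε ?_ ?_ ?_ ?_ hc0 ?_ π hπ
      · intro j
        rw [hdjs]
        linarith [hdle j]
      · rw [hdjs, hdne a ha]
        linarith
      · intro j hj
        rw [hdne' j hj]
      · intro j hj
        rw [hdne' j hj, hda]
        linarith [hdle j]
      · rw [hdne a ha]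
        linarith
      · rw [hdne a ha, hda]
        linarith
      · rw [hda]
        -- A marginal of at least `1` would make the right side of `hε2` nonpositive.
        by_contra! hcon
        have h1 : 0 ≤ c * (δ + ε) ^ 2 := by positivity
        have h2 : (p + (δ + ε)) * (1 - (p + (δ + ε))) ≤ 0 :=
          mul_nonpos_of_nonneg_of_nonpos (by positivity) (by linarith)
        linarith
      · rw [hda, hdne a ha]
        have : p + (δ + ε) - (p + 0) = δ + ε := by ring
        rwa [this]
    have hall : ∀ᶠ T : ℕ in atTop, ∀ a, a ≠ js →
        c * Real.log T ≤ expectedPlays (blockProblem e b ρ) π (block e a) T :=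
      eventually_all.2 fun a => by
        by_cases h : a = js
        · simp [h]
        · simpa [h] using hplays a h
    filter_upwards [hall, eventually_gt_atTop 1] with T hT hT1
    have hlog : 0 < Real.log T := Real.log_pos (by exact_mod_cast hT1)
    have hreg : b * δ * ((k * M - 1) * (c * Real.log T)) ≤
        regret (blockProblem e b ρ) π (block e js) T := by
      rw [regret_eq_sum hbdd]
      have himg : (blockProblem e b ρ).actions = Finset.univ.image (block e) := rfl
      rw [himg, Finset.sum_image (block_injective e hm).injOn,
        ← Finset.add_sum_erase _ _ (Finset.mem_univ js)]
      simp only [sub_self, zero_mul, zero_add]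
      have hcard : ((Finset.univ.erase js).card : ℝ) = k * M - 1 := by
        rw [Finset.card_erase_of_mem (Finset.mem_univ _), Finset.card_univ, Nat.cast_sub]
        · simp
        · exact Fintype.card_pos
      calc b * δ * ((k * M - 1) * (c * Real.log T))
          = ∑ _j ∈ Finset.univ.erase js, b * δ * (c * Real.log T) := by
            rw [Finset.sum_const, nsmul_eq_mul, hcard]
            ring
        _ ≤ _ := Finset.sum_le_sum fun j hj => by
            have hj' := Finset.ne_of_mem_erase hj
            rw [hgapval (block e j) (Finset.mem_image_of_mem _ (Finset.mem_univ _))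
              ((block_injective e hm).ne hj')]
            exact mul_le_mul_of_nonneg_left (hT j hj') (by positivity)
    calc (k * b * b * (1 - 2 / (k * M)) / 4 : ℝ)
        = b * δ / Real.log T * (b * δ * ((k * M - 1) * (c * Real.log T))) := by
          rw [hc]
          have := hkM1.ne'
          field_simp
      _ ≤ _ := mul_le_mul_of_nonneg_left hreg (by positivity)

end SemiBandit

/-! ### Reduction to the block parameters. -/

theorem theorem3 (n m s : ℕ) (hn : 0 < n) (hm : 0 < m) (hs : 0 < s)
    (hmn : m ∣ n) (hsn : s ∣ n) (hsm : ∃ k : ℕ, max 1 ((s : ℝ) / (m : ℝ)) = k)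
    (hmn2 : 2 ≤ n / m) (hsn2 : 2 ≤ n / s)
    (Δ : ℝ) (hΔ : 0 < Δ) (hΔ' : Δ ≤ (m : ℝ) * s / (2 * ((n : ℝ) - m)))
    (π : SemiBandit.Policy n) (hπ : π.IsConsistent m s) :
    ∃ B : SemiBandit.Problem n, B.IsSparse m s ∧
      ∃ Astar, B.IsOptimal Astar ∧
        (∃ A ∈ B.actions, A ≠ Astar) ∧
        (∀ A ∈ B.actions, A ≠ Astar → B.value Astar - B.value A = Δ) ∧
        (((s : ℝ) * min (s : ℝ) (m : ℝ) * (1 - 2 * (m : ℝ) / (n : ℝ)) / 4 : ℝ) : EReal) ≤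
          liminf (fun T : ℕ =>
            ((Δ / Real.log T * SemiBandit.regret B π Astar T : ℝ) : EReal)) atTop := by
  have hmR : (0 : ℝ) < m := by exact_mod_cast hm
  -- If `s ≤ m`, a single partly active block suffices: `k = 1`, `M = n / m`, `b = s`. If `m ≤ s`,
  -- whole blocks are active: `k = s / m`, `M = n / s`, `b = m`.
  obtain ⟨k, M, b, hk, hM, hb0, hb, hnk, hsk, hmin⟩ : ∃ k M b : ℕ, 0 < k ∧ 2 ≤ M ∧ 0 < b ∧
      b ≤ m ∧ n = k * M * m ∧ s = k * b ∧ min (s : ℝ) m = b := by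
    rcases le_total s m with h | h
    · refine ⟨1, n / m, s, one_pos, hmn2, hs, h, ?_, (one_mul s).symm,
        min_eq_left (by exact_mod_cast h)⟩
      rw [one_mul, Nat.div_mul_cancel hmn]
    · obtain ⟨k, hk⟩ := hsm
      have h1 : (1 : ℝ) ≤ (s : ℝ) / m := (one_le_div hmR).2 (by exact_mod_cast h)
      rw [max_eq_right h1] at hk
      have hs' : s = k * m := by
        rw [div_eq_iff hmR.ne'] at hk
        exact_mod_cast hk
      refine ⟨k, n / s, m, Nat.pos_of_ne_zero ?_, hsn2, hm, le_rfl, ?_, hs',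
        min_eq_right (by exact_mod_cast h)⟩
      · rintro rfl
        simp at hs'
        omega
      · calc n = s * (n / s) := (Nat.mul_div_cancel' hsn).symm
          _ = k * m * (n / s) := by rw [← hs']
          _ = k * (n / s) * m := by ring
  have hbR : (0 : ℝ) < b := by exact_mod_cast hb0
  have hkM : (2 : ℝ) ≤ k * M := by
    exact_mod_cast (hM.trans (Nat.le_mul_of_pos_left M hk))
  have hkM1 : (0 : ℝ) < k * M - 1 := by linarith
  have hnR : (n : ℝ) = k * M * m := by exact_mod_cast hnk
  have hsR : (s : ℝ) = k * b := by exact_mod_cast hsk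
  -- The gap per active arm is `δ = Δ / b`; in these parameters the assumed bound on `Δ` is `b * k /
  -- (2 * (k * M - 1))`.
  have hδ' : Δ / b ≤ k / (2 * (k * M - 1)) := by
    have h1 : (m : ℝ) * s / (2 * ((n : ℝ) - m)) = k / (2 * (k * M - 1)) * b := by
      have h2 : (n : ℝ) - m = (k * M - 1) * m := by rw [hnR]; ring
      rw [h2, hsR]
      have := hkM1.ne'
      field_simp
    rw [div_le_iff₀ hbR, ← h1]
    exact hΔ'
  have hbΔ : b * (Δ / b) = Δ := mul_div_cancel₀ _ hbR.ne'
  obtain ⟨B, hB, Astar, hopt, hne, hgap, hT⟩ :=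
    SemiBandit.exists_hard_problem hk hM hb0 hb hnk (div_pos hΔ hbR) hδ' π (hsk ▸ hπ)
  rw [hbΔ] at hgap
  refine ⟨B, hsk ▸ hB, Astar, hopt, hne, hgap, ?_⟩
  refine le_liminf_of_le (by isBoundedDefault) ?_
  filter_upwards [hT] with T hT
  rw [hbΔ] at hT
  refine EReal.coe_le_coe_iff.2 (le_trans (le_of_eq ?_) hT)
  rw [hmin, hsR, hnR]
  field_simp
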